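/- Let $d\ge 2$. The $d$-ary dendrimer $D_{n,d}$ ($n\ge 1$) is the tree with vertex set $\{1,\dots,n\}$ defined inductively as follows: $D_{1,d}$ is the single vertex $1$, and $D_{n,d}$ is obtained from $D_{n-1,d}$ by attaching a new leaf $n$ to the smallest-numbered vertex of $D_{n-1,d}$ whose degree is at most $d$. The Wiener polynomial of a finite connected graph $G$ is $W(G;q)=\sum_{\{u,v\}}q^{d(u,v)}$, the sum being over all unordered pairs of distinct vertices of $G$, where $d(u,v)$ is the distance between $u$ and $v$. For $k\ge 0$ put $$n_k=2+(d+1)\frac{d^k-1}{d-1},\qquad m_k=3+2d\,\frac{d^k-1}{d-1},\qquad p_k=m_k+2d^k-1.$$ **Theorem.** Let $d\ge 2$, $n\ge 1$, and write $W=W(D_{n,d};q)=\sum_{i\ge 0}a_iq^i$. Then the sequence $(a_i)_{i\ge 0}$ is unimodal, i.e. there is an index $j$ with $a_0\le a_1\le\dots\le a_j\ge a_{j+1}\ge\cdots$. Furthermore, let $k\ge 0$. 1. If $n_k\le n<p_k$, then $a_{2k}$ or $a_{2k+1}$ is a maximum of the sequence $(a_i)_{i\ge 0}$. 2. If $p_k\le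 n<n_{k+1}$, then $a_{2k+2}$ is a maximum of the sequence; moreover $\deg W=2k+2$, so that the coefficients up to the degree are weakly increasing: $a_0\le a_1\le\dots\le a_{2k+2}$. -/

import Mathlib

/-- The Wiener polynomial `W(G; q) = ∑_{{u, v}} q ^ d(u, v)` of a finite graph, the sum being over
all unordered pairs of distinct vertices. -/
noncomputable def wienerPolynomial {V : Type*} [Fintype V] (G : SimpleGraph V) :
    Polynomial ℕ :=
  open Classical in
  ∑ e ∈ (Finset.univ : Finset (Sym2 V)).filter (fun e => ¬ e.IsDiag),
    Polynomial.X ^ Sym2.lift ⟨fun u v => G.dist u v, fun _ _ => SimpleGraph.dist_comm⟩ e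

/-- The edges of the `d`-ary dendrimer on the nodes `1, …, n`, as a graph on `ℕ` in which all
numbers outside `{1, …, n}` are isolated. The one-node dendrimer has no edges, and the next
node `n` is attached to the smallest of the nodes `1, …, n - 1` whose degree is at most `d`. -/
noncomputable def dendrimerEdges (d : ℕ) : ℕ → SimpleGraph ℕ
  | 0 => ⊥
  | 1 => ⊥
  | n + 2 =>
      dendrimerEdges d (n + 1) ⊔
        SimpleGraph.edge
          (sInf {v : ℕ | v ∈ Set.Icc 1 (n + 1) ∧
            ((dendrimerEdges d (n + 1)).neighborSet v).encard ≤ d})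
          (n + 2)

/-- The `d`-ary dendrimer `D_{n,d}`, with vertex set `{1, …, n}`. -/
noncomputable def dendrimer (n d : ℕ) : SimpleGraph (Set.Icc 1 n) :=
  (dendrimerEdges d n).induce (Set.Icc 1 n)

/-- `n_k = 2 + (d + 1) (d ^ k - 1) / (d - 1)`, the quotient being written as the geometric sum
`1 + d + ⋯ + d ^ (k - 1)`. -/
def dendrimerN (d k : ℕ) : ℕ := 2 + (d + 1) * ∑ i ∈ Finset.range k, d ^ i

/-- `m_k = 3 + 2 d (d ^ k - 1) / (d - 1)`, the quotient being written as the geometric sum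
`1 + d + ⋯ + d ^ (k - 1)`. -/
def dendrimerM (d k : ℕ) : ℕ := 3 + 2 * d * ∑ i ∈ Finset.range k, d ^ i

/-- `p_k = m_k + 2 d ^ k - 1` (the subtraction is never truncated, as `m_k ≥ 3`). -/
def dendrimerP (d k : ℕ) : ℕ := dendrimerM d k + 2 * d ^ k - 1

theorem dendrimerN_closed_form (d k : ℕ) (hd : 2 ≤ d) :
    (dendrimerN d k : ℚ) = 2 + (d + 1) * (((d : ℚ) ^ k - 1) / (d - 1)) := by
  have h : (d : ℚ) ≠ 1 := by
    have : (2 : ℚ) ≤ d := by exact_mod_cast hd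
    linarith
  simp [dendrimerN, geom_sum_eq h]

theorem dendrimerM_closed_form (d k : ℕ) (hd : 2 ≤ d) :
    (dendrimerM d k : ℚ) = 3 + 2 * d * (((d : ℚ) ^ k - 1) / (d - 1)) := by
  have h : (d : ℚ) ≠ 1 := by
    have : (2 : ℚ) ≤ d := by exact_mod_cast hd
    linarith
  simp [dendrimerM, geom_sum_eq h]

/-- A sequence is unimodal if it weakly increases up to some index and weakly decreases from
that index on. -/
def IsUnimodal {α : Type*} [Preorder α] (a : ℕ → α) : Prop :=
  ∃ k : ℕ, (∀ i, i < k → a i ≤ a (i + 1)) ∧ (∀ i, k ≤ i → a (i + 1) ≤ a i)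

/-! The coefficients are followed while the tree grows node by node. The greedy rule has a closed
form: node `n` hangs from `(n - 3) / d + 1`. Hence `dendrimerN d k` is the first node of depth `k +
1`, that depth holds `(d + 1) * d ^ k` nodes, and passing to the parent divides the index `l` within
a depth by `d`. Distances are thus read off the base-`d` digits of `l`, and the node with index `l`
creates `d ^ m` pairs at distance `2m + 1` for `m ≤ k`, `d ^ m * (1 + digit m of l)` pairs at
distance `2m + 2` for `m < k`, and `d ^ k * (l / d ^ k)` pairs at distance `2k + 2`
(`sphereCard_odd`, `sphereCard_even`).

These increments increase weakly up to distance `2k + 1`, so only two comparisons remain. With `L`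
nodes placed at depth `k + 1`, `a_{2k+1} = d ^ k * L` and `a_{2k+2} = d ^ k * ∑ l < L, l / d ^ k`,
which cross at `L = 3 * d ^ k`, that is, at `n + 1 = p_k + 1`. By then `a_{2k}` is overtaken by
`a_{2k+1}` (`pairCount_three_mul`). So the peak is at `2k` or `2k + 1` before the threshold and at
`2k + 2` after it; the bounds needed at a complete depth propagate by induction on `k`
(`IsCompleteLevel.succ`). -/

/-! ### Closed form of the greedy attachment rule. -/

/-- The node to which the node `n ≥ 2` of a `d`-ary dendrimer is attached. -/
def dendrimerParent (d n : ℕ) : ℕ := min ((n - 3) / d + 1) (n - 1)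

/-- For `n ≥ 1` the `min` matters only at the root, whose parent becomes the dummy node `0`; this
makes recursion along parents terminate. -/
theorem dendrimerParent_lt {d n : ℕ} (hn : 1 ≤ n) : dendrimerParent d n < n := by
  have : dendrimerParent d n ≤ n - 1 := min_le_right _ _
  omega

theorem dendrimerParent_eq {d n : ℕ} (hn : 2 ≤ n) :
    dendrimerParent d n = (n - 3) / d + 1 := by
  refine min_eq_left ?_
  rcases hn.eq_or_lt with rfl | h
  · simp
  · have := Nat.div_le_self (n - 3) d
    omega

theorem one_le_dendrimerParent {d n : ℕ} (hn : 2 ≤ n) : 1 ≤ dendrimerParent d n := by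
  rw [dendrimerParent_eq hn]
  exact Nat.le_add_left _ _

/-- The root has `d + 1` children and every other node has `d`, so the children of `1, …, u` end at
`u * d + 2`. -/
theorem dendrimerParent_le_iff {d n u : ℕ} (hd : 1 ≤ d) (hn : 2 ≤ n) (hu : 1 ≤ u) :
    dendrimerParent d n ≤ u ↔ n ≤ u * d + 2 := by
  obtain ⟨u, rfl⟩ : ∃ w, u = w + 1 := ⟨u - 1, by omega⟩
  rw [dendrimerParent_eq hn, Nat.add_le_add_iff_right, ← Nat.lt_add_one_iff,
    Nat.div_lt_iff_lt_mul (by omega)]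
  have : 1 ≤ (u + 1) * d := Nat.mul_pos (by omega) hd
  omega

/-- Two nodes are joined in the graph where every node from `2` to `n` is joined to its parent. -/
def IsParentEdge (d n u v : ℕ) : Prop :=
  2 ≤ v ∧ v ≤ n ∧ u = dendrimerParent d v

theorem encard_neighborSet_le {d n : ℕ} (hd : 1 ≤ d) {G : SimpleGraph ℕ}
    (hG : ∀ u v, G.Adj u v ↔ IsParentEdge d (n + 1) u v ∨ IsParentEdge d (n + 1) v u) :
    (G.neighborSet (dendrimerParent d (n + 2))).encard ≤ d := by
  set p := dendrimerParent d (n + 2) with hp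
  have hp1 : 1 ≤ p := one_le_dendrimerParent (by omega)
  have hle : n + 2 ≤ p * d + 2 := (dendrimerParent_le_iff hd (by omega) hp1).1 le_rfl
  rcases hp1.eq_or_lt with h1 | h2
  · have hsub : G.neighborSet p ⊆ (Finset.Ico 2 (n + 2) : Finset ℕ) := by
      intro w hw
      rw [SimpleGraph.mem_neighborSet, hG] at hw
      rw [Finset.coe_Ico, Set.mem_Ico]
      rcases hw with ⟨h, h', -⟩ | ⟨h, -⟩ <;> omega
    refine (Set.encard_le_encard hsub).trans ?_
    rw [Set.encard_coe_eq_coe_finsetCard, Nat.card_Ico]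
    rw [← h1] at hle
    exact_mod_cast (by omega : n + 2 - 2 ≤ d)
  -- Away from the root: the parent of `p`, and at most `d - 1` children, because the last place `p
  -- * d + 2` is still free.
  · have hsub : G.neighborSet p ⊆
        (insert (dendrimerParent d p) (Finset.Ico ((p - 1) * d + 3) (n + 2)) : Finset ℕ) := by
      intro w hw
      rw [SimpleGraph.mem_neighborSet, hG] at hw
      rw [Finset.coe_insert, Finset.coe_Ico, Set.mem_insert_iff, Set.mem_Ico]
      rcases hw with ⟨h, h', h''⟩ | ⟨h, h', h''⟩
      · refine Or.inr ⟨?_, by omega⟩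
        by_contra hc
        have := (dendrimerParent_le_iff (u := p - 1) hd h (by omega)).2 (by omega)
        omega
      · exact Or.inl h''
    refine (Set.encard_le_encard hsub).trans ?_
    rw [Set.encard_coe_eq_coe_finsetCard]
    refine Nat.cast_le.2 ((Finset.card_insert_le _ _).trans ?_)
    rw [Nat.card_Ico]
    obtain ⟨q, hq⟩ : ∃ q, p = q + 1 := ⟨p - 1, by omega⟩
    rw [hq] at hle ⊢
    rw [add_mul, one_mul] at hle
    simp only [Nat.add_sub_cancel]
    omega

theorem lt_encard_neighborSet {d n u : ℕ} (hd : 1 ≤ d) {G : SimpleGraph ℕ}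
    (hG : ∀ u v, G.Adj u v ↔ IsParentEdge d (n + 1) u v ∨ IsParentEdge d (n + 1) v u)
    (hu : 1 ≤ u) (hup : u < dendrimerParent d (n + 2)) :
    (d : ℕ∞) < (G.neighborSet u).encard := by
  have hlt : u * d + 2 < n + 2 := by
    by_contra hc
    exact absurd ((dendrimerParent_le_iff hd (by omega) hu).2 (not_lt.1 hc)) (by omega)
  have hchild : ∀ w, (u - 1) * d + 3 ≤ w → w ≤ u * d + 2 → w ∈ G.neighborSet u := by
    intro w h1 h2
    rw [SimpleGraph.mem_neighborSet, hG]
    refine Or.inl ⟨by omega, by omega, le_antisymm ?_ ?_⟩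
    · rcases hu.eq_or_lt with h | h
      · rw [← h]
        exact one_le_dendrimerParent (by omega)
      · by_contra hc
        have := (dendrimerParent_le_iff (d := d) (n := w) (u := u - 1) hd (by omega)
          (by omega)).1 (by omega)
        omega
    · exact (dendrimerParent_le_iff hd (by omega) hu).2 h2
  have huu : dendrimerParent d (n + 2) < n + 2 := dendrimerParent_lt (by omega)
  -- One neighbour beyond the `d` listed children: the parent, or the extra child `2` if `u` is the
  -- root.
  obtain ⟨x, hx, hxlt⟩ : ∃ x ∈ G.neighborSet u, x < (u - 1) * d + 3 := by
    rcases hu.eq_or_lt with h | h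
    · refine ⟨2, ?_, by omega⟩
      rw [SimpleGraph.mem_neighborSet, hG]
      refine Or.inl ⟨le_rfl, by omega, ?_⟩
      rw [dendrimerParent_eq le_rfl]
      simp [← h]
    · refine ⟨dendrimerParent d u, ?_, ?_⟩
      · rw [SimpleGraph.mem_neighborSet, hG]
        exact Or.inr ⟨h, by omega, rfl⟩
      · have := dendrimerParent_lt (d := d) hu
        have := Nat.le_mul_of_pos_right (u - 1) hd
        omega
  have hsub : ((insert x (Finset.Icc ((u - 1) * d + 3) (u * d + 2)) : Finset ℕ) : Set ℕ) ⊆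
      G.neighborSet u := by
    intro w hw
    rw [Finset.coe_insert, Finset.coe_Icc, Set.mem_insert_iff, Set.mem_Icc] at hw
    rcases hw with rfl | ⟨h, h'⟩
    · exact hx
    · exact hchild w h h'
  refine lt_of_lt_of_le ?_ (Set.encard_le_encard hsub)
  rw [Set.encard_coe_eq_coe_finsetCard, Finset.card_insert_of_notMem
    (by rw [Finset.mem_Icc]; omega), Nat.card_Icc]
  obtain ⟨q, hq⟩ : ∃ q, u = q + 1 := ⟨u - 1, by omega⟩
  rw [hq, add_mul, one_mul]
  simp only [Nat.add_sub_cancel]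
  exact_mod_cast (by omega : d < q * d + d + 2 + 1 - (q * d + 3) + 1)

theorem dendrimerEdges_adj {d : ℕ} (hd : 1 ≤ d) (n u v : ℕ) :
    (dendrimerEdges d n).Adj u v ↔ IsParentEdge d n u v ∨ IsParentEdge d n v u := by
  induction n using Nat.strong_induction_on generalizing u v with
  | _ n ih =>
    match n, ih with
    | 0, _ =>
      simp only [dendrimerEdges, SimpleGraph.bot_adj, IsParentEdge, false_iff]
      rintro (⟨h, h', -⟩ | ⟨h, h', -⟩) <;> omega
    | 1, _ =>
      simp only [dendrimerEdges, SimpleGraph.bot_adj, IsParentEdge, false_iff]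
      rintro (⟨h, h', -⟩ | ⟨h, h', -⟩) <;> omega
    | n + 2, ih =>
      have hG := ih (n + 1) (by omega)
      have hlt : dendrimerParent d (n + 2) < n + 2 := dendrimerParent_lt (by omega)
      have hinf : sInf {v : ℕ | v ∈ Set.Icc 1 (n + 1) ∧
          ((dendrimerEdges d (n + 1)).neighborSet v).encard ≤ d} =
          dendrimerParent d (n + 2) := by
        refine IsLeast.csInf_eq ⟨⟨⟨one_le_dendrimerParent (by omega), by omega⟩,
          encard_neighborSet_le hd hG⟩, ?_⟩
        rintro w ⟨⟨hw, -⟩, hw'⟩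
        by_contra hc
        exact absurd (lt_encard_neighborSet hd hG hw (not_le.1 hc)) (not_lt.2 hw')
      rw [dendrimerEdges, SimpleGraph.sup_adj, hG, hinf, SimpleGraph.edge_adj]
      constructor
      · rintro ((⟨h, h', h''⟩ | ⟨h, h', h''⟩) | ⟨⟨rfl, rfl⟩ | ⟨rfl, rfl⟩, -⟩)
        · exact Or.inl ⟨h, by omega, h''⟩
        · exact Or.inr ⟨h, by omega, h''⟩
        · exact Or.inl ⟨by omega, le_rfl, rfl⟩
        · exact Or.inr ⟨by omega, le_rfl, rfl⟩
      · rintro (⟨h, h', h''⟩ | ⟨h, h', h''⟩)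
        · rcases h'.eq_or_lt with rfl | hl
          · exact Or.inr ⟨Or.inl ⟨h'', rfl⟩, by omega⟩
          · exact Or.inl (Or.inl ⟨h, by omega, h''⟩)
        · rcases h'.eq_or_lt with rfl | hl
          · exact Or.inr ⟨Or.inr ⟨rfl, h''⟩, by omega⟩
          · exact Or.inl (Or.inr ⟨h, by omega, h''⟩)

/-! ### Distances by climbing to parents. -/

/-- The distance between two nodes, computed by moving the larger one to its parent until the
nodes coincide. -/
def dendrimerDist (d u v : ℕ) : ℕ :=
  if u = v then 0
  else if v < u then dendrimerDist d (dendrimerParent d u) v + 1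
  else dendrimerDist d u (dendrimerParent d v) + 1
termination_by u + v
decreasing_by
  · have := dendrimerParent_lt (d := d) (n := u) (by omega)
    omega
  · have := dendrimerParent_lt (d := d) (n := v) (by omega)
    omega

@[simp] theorem dendrimerDist_self (d u : ℕ) : dendrimerDist d u u = 0 := by
  rw [dendrimerDist, if_pos rfl]

theorem dendrimerDist_of_gt {d u v : ℕ} (h : v < u) :
    dendrimerDist d u v = dendrimerDist d (dendrimerParent d u) v + 1 := by
  rw [dendrimerDist, if_neg h.ne', if_pos h]

theorem dendrimerDist_of_lt {d u v : ℕ} (h : u < v) :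
    dendrimerDist d u v = dendrimerDist d u (dendrimerParent d v) + 1 := by
  rw [dendrimerDist, if_neg h.ne, if_neg h.not_gt]

theorem dendrimerDist_comm (d u v : ℕ) : dendrimerDist d u v = dendrimerDist d v u := by
  obtain ⟨s, hs⟩ : ∃ s, s = u + v := ⟨_, rfl⟩
  induction s using Nat.strong_induction_on generalizing u v with
  | _ s ih =>
    rcases lt_trichotomy u v with h | rfl | h
    · have := dendrimerParent_lt (d := d) (n := v) (by omega)
      rw [dendrimerDist_of_lt h, dendrimerDist_of_gt h, ih _ (by omega) _ _ rfl]
    · rfl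
    · have := dendrimerParent_lt (d := d) (n := u) (by omega)
      rw [dendrimerDist_of_lt h, dendrimerDist_of_gt h, ih _ (by omega) _ _ rfl]

/-- The function changes by at most one along an edge, so no walk is shorter than its value. -/
theorem dendrimerDist_parent (d : ℕ) {u : ℕ} (hu : 1 ≤ u) (v : ℕ) :
    dendrimerDist d u v ≤ dendrimerDist d (dendrimerParent d u) v + 1 ∧
      dendrimerDist d (dendrimerParent d u) v ≤ dendrimerDist d u v + 1 := by
  induction v using Nat.strong_induction_on with
  | _ v ih =>
    have hp := dendrimerParent_lt (d := d) hu
    rcases lt_trichotomy u v with h | rfl | h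
    · rw [dendrimerDist_of_lt h, dendrimerDist_of_lt (hp.trans h)]
      have := ih _ (dendrimerParent_lt (d := d) (n := v) (by omega))
      omega
    · rw [dendrimerDist_of_lt hp]
      simp
    · rw [dendrimerDist_of_gt h]
      omega

theorem exists_walk_length_eq {d n : ℕ} (hd : 1 ≤ d) (u v : Set.Icc 1 n) :
    ∃ p : (dendrimer n d).Walk u v, p.length = dendrimerDist d u v := by
  obtain ⟨s, hs⟩ : ∃ s, s = (u : ℕ) + v := ⟨_, rfl⟩
  induction s using Nat.strong_induction_on generalizing u v with
  | _ s ih =>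
    have hadj : ∀ w w' : Set.Icc 1 n, 2 ≤ (w : ℕ) → (w' : ℕ) = dendrimerParent d w →
        (dendrimer n d).Adj w w' := by
      intro w w' hw hw'
      rw [dendrimer, SimpleGraph.comap_adj]
      exact (dendrimerEdges_adj hd n w w').2 (Or.inr ⟨hw, w.2.2, hw'⟩)
    have hmem : ∀ w : Set.Icc 1 n, 2 ≤ (w : ℕ) → dendrimerParent d w ∈ Set.Icc 1 n := by
      intro w hw
      have := dendrimerParent_lt (d := d) w.2.1
      exact ⟨one_le_dendrimerParent hw, this.le.trans w.2.2⟩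
    have hu := u.2.1
    have hv := v.2.1
    rcases lt_trichotomy (u : ℕ) v with h | h | h
    · have hlt := dendrimerParent_lt (d := d) hv
      obtain ⟨p, hp⟩ := ih (u + dendrimerParent d v) (by omega) u ⟨_, hmem v (by omega)⟩ rfl
      refine ⟨p.concat (hadj _ _ (by omega) rfl).symm, ?_⟩
      rw [SimpleGraph.Walk.length_concat, hp, dendrimerDist_of_lt h]
    · obtain rfl := Subtype.ext h
      exact ⟨SimpleGraph.Walk.nil, by simp⟩
    · have hlt := dendrimerParent_lt (d := d) hu
      obtain ⟨p, hp⟩ := ih (dendrimerParent d u + v) (by omega) ⟨_, hmem u (by omega)⟩ v rfl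
      refine ⟨SimpleGraph.Walk.cons (hadj _ _ (by omega) rfl) p, ?_⟩
      rw [SimpleGraph.Walk.length_cons, hp, dendrimerDist_of_gt h]

theorem dendrimerDist_le_length {d n : ℕ} (hd : 1 ≤ d) {u v : Set.Icc 1 n}
    (p : (dendrimer n d).Walk u v) : dendrimerDist d u v ≤ p.length := by
  induction p with
  | nil => simp
  | @cons u w v h p ih =>
    rw [SimpleGraph.Walk.length_cons]
    rw [dendrimer, SimpleGraph.comap_adj] at h
    rcases (dendrimerEdges_adj hd n u w).1 h with ⟨h2, -, h'⟩ | ⟨h2, -, h'⟩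
    · have := (dendrimerDist_parent d (u := w) (by omega) v).2
      rw [← h'] at this
      omega
    · have := (dendrimerDist_parent d (u := u) (by omega) v).1
      rw [← h'] at this
      omega

theorem dist_dendrimer {d n : ℕ} (hd : 1 ≤ d) (u v : Set.Icc 1 n) :
    (dendrimer n d).dist u v = dendrimerDist d u v := by
  obtain ⟨p, hp⟩ := exists_walk_length_eq hd u v
  refine le_antisymm (hp ▸ SimpleGraph.dist_le p) ?_
  obtain ⟨q, hq⟩ := p.reachable.exists_walk_length_eq_dist
  exact hq ▸ dendrimerDist_le_length hd q

/-! ### Coefficients as sums of contributions of single nodes, each pair being charged to its larger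
node. -/

/-- The number of nodes smaller than `u` at distance `i` from `u`. -/
def sphereCard (d u i : ℕ) : ℕ := ((Finset.Ico 1 u).filter fun v => dendrimerDist d u v = i).card

theorem coeff_wienerPolynomial_dendrimer {d n : ℕ} (hd : 1 ≤ d) (i : ℕ) :
    (wienerPolynomial (dendrimer n d)).coeff i = ∑ u ∈ Finset.Icc 1 n, sphereCard d u i := by
  classical
  have h := Finset.sum_sym2_filter_not_isDiag (Finset.univ : Finset (Set.Icc 1 n))
    (fun e => (Polynomial.X ^ Sym2.lift
      ⟨fun u v => (dendrimer n d).dist u v, fun _ _ => SimpleGraph.dist_comm⟩ e : Polynomial ℕ))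
  rw [Finset.sym2_univ] at h
  have h' : wienerPolynomial (dendrimer n d) =
      ∑ x ∈ (Finset.univ : Finset (Set.Icc 1 n)).offDiag with x.1 < x.2,
        Polynomial.X ^ (dendrimer n d).dist x.1 x.2 := by
    unfold wienerPolynomial
    convert h
    rfl
  rw [h', Polynomial.finsetSum_coeff]
  simp only [Polynomial.coeff_X_pow, dist_dendrimer hd]
  rw [← Finset.card_filter]
  simp only [sphereCard]
  rw [← Finset.card_sigma]
  refine Finset.card_bij (fun x _ => ⟨(x.2 : ℕ), (x.1 : ℕ)⟩) ?_ ?_ ?_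
  · rintro ⟨x, y⟩ hxy
    simp only [Finset.mem_filter, Finset.mem_offDiag, Finset.mem_univ, true_and] at hxy
    have hlt : (x : ℕ) < y := hxy.1.2
    simp only [Finset.mem_sigma, Finset.mem_filter, Finset.mem_Icc, Finset.mem_Ico]
    exact ⟨y.2, ⟨x.2.1, hlt⟩, by rw [dendrimerDist_comm]; exact hxy.2.symm⟩
  · rintro ⟨x, y⟩ - ⟨x', y'⟩ - hxy
    simp only [Sigma.mk.injEq, heq_eq_eq] at hxy
    exact Prod.ext (Subtype.ext hxy.2) (Subtype.ext hxy.1)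
  · rintro ⟨y, x⟩ hxy
    simp only [Finset.mem_sigma, Finset.mem_filter, Finset.mem_Icc, Finset.mem_Ico] at hxy
    obtain ⟨⟨hy, hyn⟩, ⟨hx, hlt⟩, hi⟩ := hxy
    refine ⟨(⟨x, hx, by omega⟩, ⟨y, hy, hyn⟩), ?_, rfl⟩
    simp only [Finset.mem_filter, Finset.mem_offDiag, Finset.mem_univ, true_and]
    refine ⟨⟨?_, hlt⟩, by rw [dendrimerDist_comm]; exact hi.symm⟩
    exact fun h => hlt.ne (congrArg Subtype.val h)

theorem dendrimerDist_eq_zero {d u v : ℕ} : dendrimerDist d u v = 0 ↔ u = v := by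
  refine ⟨fun h => ?_, fun h => h ▸ dendrimerDist_self d u⟩
  rcases lt_trichotomy u v with h' | h' | h'
  · rw [dendrimerDist_of_lt h'] at h
    omega
  · exact h'
  · rw [dendrimerDist_of_gt h'] at h
    omega

/-! ### Coordinates by level and index. -/

theorem dendrimerN_zero (d : ℕ) : dendrimerN d 0 = 2 := by simp [dendrimerN]

theorem dendrimerN_succ (d h : ℕ) :
    dendrimerN d (h + 1) = dendrimerN d h + (d + 1) * d ^ h := by
  rw [dendrimerN, dendrimerN, Finset.sum_range_succ]
  ring

theorem two_le_dendrimerN (d h : ℕ) : 2 ≤ dendrimerN d h := Nat.le_add_right _ _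

theorem dendrimerParent_level_zero {d l : ℕ} (hl : l < d + 1) :
    dendrimerParent d (dendrimerN d 0 + l) = 1 := by
  rw [dendrimerN_zero]
  rcases l.eq_zero_or_pos with rfl | h
  · rw [dendrimerParent_eq le_rfl]
    simp
  · have h1 := one_le_dendrimerParent (d := d) (n := 2 + l) (by omega)
    have := (dendrimerParent_le_iff (d := d) (n := 2 + l) (u := 1) (by omega) (by omega)
      le_rfl).2 (by omega)
    omega

theorem dendrimerParent_level_succ {d : ℕ} (hd : 1 ≤ d) (h l : ℕ) :
    dendrimerParent d (dendrimerN d (h + 1) + l) = dendrimerN d h + l / d := by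
  have h2 := two_le_dendrimerN d (h + 1)
  have key : dendrimerN d (h + 1) + l - 3 = l + d * (1 + (d + 1) * ∑ i ∈ Finset.range h, d ^ i) := by
    have : dendrimerN d (h + 1) = 3 + d * (1 + (d + 1) * ∑ i ∈ Finset.range h, d ^ i) := by
      rw [dendrimerN, Finset.sum_range_succ', pow_zero]
      simp only [pow_succ, ← Finset.sum_mul]
      ring
    omega
  rw [dendrimerParent_eq (by omega), key, Nat.add_mul_div_left _ _ hd, dendrimerN]
  ring

theorem dendrimerDist_level_zero {d l l' : ℕ} (hl : l < d + 1) (hl' : l' < d + 1)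
    (hne : l ≠ l') : dendrimerDist d (dendrimerN d 0 + l) (dendrimerN d 0 + l') = 2 := by
  have hN := dendrimerN_zero d
  have key : ∀ a b, a < d + 1 → b < d + 1 → b < a →
      dendrimerDist d (dendrimerN d 0 + a) (dendrimerN d 0 + b) = 2 := by
    intro a b ha hb hba
    rw [dendrimerDist_of_gt (by omega), dendrimerParent_level_zero ha,
      dendrimerDist_of_lt (by omega), dendrimerParent_level_zero hb, dendrimerDist_self]
  rcases hne.lt_or_gt with h | h
  · rw [dendrimerDist_comm]
    exact key _ _ hl' hl h
  · exact key _ _ hl hl' h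

theorem dendrimerDist_level_succ {d h l l' : ℕ} (hd : 1 ≤ d) (hl : l < (d + 1) * d ^ (h + 1))
    (hl' : l' < (d + 1) * d ^ (h + 1)) (hne : l ≠ l') :
    dendrimerDist d (dendrimerN d (h + 1) + l) (dendrimerN d (h + 1) + l') =
      dendrimerDist d (dendrimerN d h + l / d) (dendrimerN d h + l' / d) + 2 := by
  have key : ∀ a b, a < (d + 1) * d ^ (h + 1) → b < a →
      dendrimerDist d (dendrimerN d (h + 1) + a) (dendrimerN d (h + 1) + b) =
        dendrimerDist d (dendrimerN d h + a / d) (dendrimerN d h + b / d) + 2 := by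
    intro a b ha hba
    have : a / d < (d + 1) * d ^ h := by
      rw [Nat.div_lt_iff_lt_mul hd, mul_assoc, ← pow_succ]
      exact ha
    have hN := dendrimerN_succ d h
    rw [dendrimerDist_of_gt (by omega), dendrimerParent_level_succ hd,
      dendrimerDist_of_lt (by omega), dendrimerParent_level_succ hd]
  rcases hne.lt_or_gt with h' | h'
  · rw [dendrimerDist_comm, dendrimerDist_comm d (dendrimerN d h + l / d)]
    exact key _ _ hl' h'
  · exact key _ _ hl h'

theorem div_lt_level {d h l : ℕ} (hd : 1 ≤ d) (hl : l < (d + 1) * d ^ (h + 1)) :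
    l / d < (d + 1) * d ^ h := by
  rw [Nat.div_lt_iff_lt_mul hd, mul_assoc, ← pow_succ]
  exact hl

theorem even_dendrimerDist_level {d : ℕ} (hd : 1 ≤ d) (h l l' : ℕ) (hl : l < (d + 1) * d ^ h)
    (hl' : l' < (d + 1) * d ^ h) :
    Even (dendrimerDist d (dendrimerN d h + l) (dendrimerN d h + l')) := by
  induction h generalizing l l' with
  | zero =>
    by_cases hne : l = l'
    · simp [hne]
    · rw [dendrimerDist_level_zero (by simpa using hl) (by simpa using hl') hne]
      exact even_two
  | succ h ih =>
    by_cases hne : l = l'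
    · simp [hne]
    · rw [dendrimerDist_level_succ hd hl hl' hne]
      exact (ih _ _ (div_lt_level hd hl) (div_lt_level hd hl')).add even_two

/-! ### Distance distribution within a level. -/

/-- The number of nodes at distance `i` from the node with index `l` of level `h + 1`, among the
first `M` nodes of that level. -/
def levelCard (d h l M i : ℕ) : ℕ :=
  ((Finset.range M).filter fun l' =>
    dendrimerDist d (dendrimerN d h + l) (dendrimerN d h + l') = i).card

theorem levelCard_odd {d h l M : ℕ} (hd : 1 ≤ d) (hl : l < (d + 1) * d ^ h)
    (hM : M ≤ (d + 1) * d ^ h) (m : ℕ) : levelCard d h l M (2 * m + 1) = 0 := by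
  rw [levelCard, Finset.card_eq_zero, Finset.filter_eq_empty_iff]
  intro l' hl' heq
  have := even_dendrimerDist_level hd h l l' hl ((Finset.mem_range.1 hl').trans_le hM)
  rw [heq] at this
  exact absurd this (by simp)

theorem levelCard_zero {d h l M : ℕ} (hl : l < M) : levelCard d h l M 0 = 1 := by
  rw [levelCard, Finset.card_eq_one]
  refine ⟨l, ?_⟩
  ext x
  simp only [Finset.mem_filter, Finset.mem_range, dendrimerDist_eq_zero, Finset.mem_singleton]
  omega

theorem levelCard_level_zero {d l M : ℕ} (hl : l < d + 1) (hM : M ≤ d + 1) (m : ℕ) :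
    levelCard d 0 l M (2 * (m + 1)) = if m = 0 then ((Finset.range M).erase l).card else 0 := by
  rw [levelCard]
  have : ∀ x ∈ Finset.range M,
      (dendrimerDist d (dendrimerN d 0 + l) (dendrimerN d 0 + x) = 2 * (m + 1) ↔
        x ≠ l ∧ m = 0) := by
    intro x hx
    by_cases hxl : x = l
    · simp [hxl]
    · rw [dendrimerDist_level_zero hl (by rw [Finset.mem_range] at hx; omega) (Ne.symm hxl)]
      omega
  rw [Finset.filter_congr this]
  split_ifs with h
  · simp [h, Finset.filter_ne']
  · simp [h]

theorem sum_range_mul_div {d : ℕ} (hd : 1 ≤ d) (M : ℕ) (f : ℕ → ℕ) :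
    ∑ x ∈ Finset.range (d * M), f (x / d) = d * ∑ x ∈ Finset.range M, f x := by
  induction M with
  | zero => simp
  | succ M ih =>
    have : ∑ x ∈ Finset.range d, f ((d * M + x) / d) = d * f M := by
      rw [Finset.sum_const_nat (m := f M), Finset.card_range]
      intro x hx
      rw [Nat.mul_add_div hd, Nat.div_eq_of_lt (Finset.mem_range.1 hx), add_zero]
    rw [Nat.mul_succ, Finset.sum_range_add, ih, Finset.sum_range_succ, mul_add, this]

theorem card_filter_range_div {d : ℕ} (hd : 1 ≤ d) (M : ℕ) (p : ℕ → Prop) [DecidablePred p] :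
    ((Finset.range (d * M)).filter fun x => p (x / d)).card =
      d * ((Finset.range M).filter p).card := by
  rw [Finset.card_filter, Finset.card_filter]
  exact sum_range_mul_div hd M fun y => if p y then 1 else 0

theorem levelCard_succ {d h l M : ℕ} (hd : 1 ≤ d) (hl : l < (d + 1) * d ^ (h + 1))
    (hM : d * M ≤ (d + 1) * d ^ (h + 1)) {i : ℕ} (hi : i ≠ 0) :
    levelCard d (h + 1) l (d * M) (i + 2) = d * levelCard d h (l / d) M i := by
  rw [levelCard, levelCard, ← card_filter_range_div hd]
  congr 1
  refine Finset.filter_congr fun x hx => ?_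
  rw [Finset.mem_range] at hx
  by_cases hxl : l = x
  · simp [hxl, hi.symm]
  · rw [dendrimerDist_level_succ hd hl (by omega) hxl, Nat.add_right_cancel_iff]

theorem levelCard_succ_two {d h l M : ℕ} (hd : 1 ≤ d) (hl : l < (d + 1) * d ^ (h + 1))
    (hM : M ≤ (d + 1) * d ^ (h + 1)) :
    levelCard d (h + 1) l M 2 =
      (((Finset.range M).filter fun x => x / d = l / d).erase l).card := by
  rw [levelCard]
  congr 1
  ext x
  rw [Finset.mem_erase, Finset.mem_filter, Finset.mem_filter, Finset.mem_range]
  by_cases hxl : l = x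
  · simp [hxl]
  · have : x < M → (dendrimerDist d (dendrimerN d (h + 1) + l) (dendrimerN d (h + 1) + x) = 2 ↔
        x / d = l / d) := by
      intro hx
      rw [dendrimerDist_level_succ hd hl (by omega) hxl, Nat.add_eq_right, dendrimerDist_eq_zero]
      omega
    constructor
    · rintro ⟨h1, h2⟩
      exact ⟨Ne.symm hxl, h1, (this h1).1 h2⟩
    · rintro ⟨-, h1, h2⟩
      exact ⟨h1, (this h1).2 h2⟩

/-- Distance `2(m + 1)` means that the paths to the root first meet `m + 1` steps up. For `m = h`
they meet at the root, which has `d` other branches with `d ^ h` nodes each. -/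
theorem levelCard_full {d : ℕ} (hd : 1 ≤ d) (h l : ℕ) (hl : l < (d + 1) * d ^ h) (m : ℕ) :
    levelCard d h l ((d + 1) * d ^ h) (2 * (m + 1)) =
      if m < h then d ^ (m + 1) - d ^ m else if m = h then d ^ (h + 1) else 0 := by
  induction h generalizing l m with
  | zero =>
    simp only [pow_zero, mul_one] at hl ⊢
    rw [levelCard_level_zero hl le_rfl, Finset.card_erase_of_mem (Finset.mem_range.2 hl)]
    simp
  | succ h ih =>
    have hsize : (d + 1) * d ^ (h + 1) = d * ((d + 1) * d ^ h) := by ring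
    rcases m with _ | m
    · rw [zero_add, mul_one, levelCard_succ_two hd hl le_rfl, Finset.card_erase_of_mem (by simp [hl]),
        hsize, card_filter_range_div hd _ (fun y => y = l / d), Finset.filter_eq',
        if_pos (Finset.mem_range.2 (div_lt_level hd hl))]
      simp
    · rw [hsize, show 2 * (m + 1 + 1) = 2 * (m + 1) + 2 by ring,
        levelCard_succ hd hl hsize.ge (by omega), ih _ (div_lt_level hd hl)]
      simp only [Nat.add_lt_add_iff_right, Nat.add_right_cancel_iff]
      split_ifs
      · rw [Nat.mul_sub]
        ring_nf
      · ring
      · rfl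

/-- For `m < h`, the earlier nodes at this distance agree with `l` in all digits above the `m`-th
and have a smaller `m`-th digit; the lower `m` digits are free. -/
theorem levelCard_initial {d : ℕ} (hd : 1 ≤ d) (h l : ℕ) (hl : l < (d + 1) * d ^ h) (m : ℕ) :
    levelCard d h l l (2 * (m + 1)) =
      if m < h then d ^ m * (l / d ^ m % d) else if m = h then d ^ h * (l / d ^ h) else 0 := by
  induction h generalizing l m with
  | zero =>
    simp only [pow_zero, mul_one] at hl ⊢
    rw [levelCard_level_zero hl hl.le, Finset.erase_eq_of_notMem (by simp)]
    simp
  | succ h ih =>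
    have hdiv := Nat.div_add_mod l d
    have hmod := Nat.mod_lt l hd
    rcases m with _ | m
    · have : ((Finset.range l).filter fun x => x / d = l / d) =
          Finset.Ico (d * (l / d)) l := by
        ext x
        rw [Finset.mem_filter, Finset.mem_range, Finset.mem_Ico, Nat.div_eq_iff hd, mul_comm]
        omega
      rw [zero_add, mul_one, levelCard_succ_two hd hl hl.le, Finset.erase_eq_of_notMem (by simp),
        this, Nat.card_Ico]
      simp
      omega
    -- The nodes from `d * (l / d)` up to `l` are siblings of `l`, at distance 2, so the range may
    -- be cut to whole families.
    · have hcut : levelCard d (h + 1) l l (2 * (m + 1) + 2) =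
          levelCard d (h + 1) l (d * (l / d)) (2 * (m + 1) + 2) := by
        rw [levelCard, levelCard]
        congr 1
        ext x
        rw [Finset.mem_filter, Finset.mem_filter, Finset.mem_range, Finset.mem_range]
        refine ⟨fun ⟨h1, h2⟩ => ⟨?_, h2⟩, fun ⟨h1, h2⟩ => ⟨by omega, h2⟩⟩
        by_contra hc
        have hx : l / d = x / d := by
          refine le_antisymm ?_ (Nat.div_le_div_right h1.le)
          rw [Nat.le_div_iff_mul_le hd, mul_comm]
          omega
        rw [dendrimerDist_level_succ hd hl (h1.trans hl) h1.ne', hx, dendrimerDist_self] at h2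
        omega
      rw [show 2 * (m + 1 + 1) = 2 * (m + 1) + 2 by ring, hcut,
        levelCard_succ hd hl (by omega) (by omega), ih _ (div_lt_level hd hl)]
      simp only [Nat.add_lt_add_iff_right, Nat.add_right_cancel_iff, Nat.div_div_eq_div_mul,
        ← pow_succ']
      split_ifs
      · ring
      · rw [pow_succ' d h]
        ring
      · rfl

/-! ### Distances to the inner levels, and the contribution of one node. -/

/-- The number of nodes at distance `i` from the node with index `l` of level `h + 1`, among the
nodes of level at most `h`. -/
def innerCard (d h l i : ℕ) : ℕ :=
  ((Finset.Ico 1 (dendrimerN d h)).filter fun v =>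
    dendrimerDist d (dendrimerN d h + l) v = i).card

theorem card_filter_Ico_add (p : ℕ → Prop) [DecidablePred p] {N M : ℕ} (hN : 1 ≤ N) :
    ((Finset.Ico 1 (N + M)).filter p).card =
      ((Finset.Ico 1 N).filter p).card + ((Finset.range M).filter fun x => p (N + x)).card := by
  simp only [Finset.card_filter]
  rw [← Finset.sum_Ico_consecutive _ hN (Nat.le_add_right N M), Finset.sum_Ico_eq_sum_range _ N]
  simp

theorem sphereCard_level (d h l i : ℕ) :
    sphereCard d (dendrimerN d h + l) i = innerCard d h l i + levelCard d h l l i :=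
  card_filter_Ico_add _ ((two_le_dendrimerN d h).trans' one_le_two)

theorem innerCard_zero (d h l : ℕ) : innerCard d h l 0 = 0 := by
  rw [innerCard, Finset.card_eq_zero, Finset.filter_eq_empty_iff]
  intro v hv h0
  rw [dendrimerDist_eq_zero] at h0
  rw [Finset.mem_Ico] at hv
  omega

theorem innerCard_succ {d : ℕ} (hd : 1 ≤ d) (h l i : ℕ) :
    innerCard d (h + 1) l (i + 1) =
      innerCard d h (l / d) i + levelCard d h (l / d) ((d + 1) * d ^ h) i := by
  rw [innerCard, innerCard, levelCard,
    ← card_filter_Ico_add (fun v => dendrimerDist d (dendrimerN d h + l / d) v = i)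
      ((two_le_dendrimerN d h).trans' one_le_two), ← dendrimerN_succ]
  congr 1
  refine Finset.filter_congr fun v hv => ?_
  rw [Finset.mem_Ico] at hv
  rw [dendrimerDist_of_gt (by omega), dendrimerParent_level_succ hd, Nat.add_right_cancel_iff]

/-- Passing to the parent lowers the distance by one and adds the complete level of the parent. The
sum telescopes: `d ^ m + (d ^ (m + 1) - d ^ m) = d ^ (m + 1)`. Odd distances gain nothing, by
parity. -/
theorem innerCard_eq {d : ℕ} (hd : 1 ≤ d) (h l : ℕ) (hl : l < (d + 1) * d ^ h) (i : ℕ) :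
    innerCard d h l i = if 1 ≤ i ∧ i ≤ 2 * h + 1 then d ^ ((i - 1) / 2) else 0 := by
  induction h generalizing l i with
  | zero =>
    rw [innerCard, show Finset.Ico 1 (dendrimerN d 0) = {1} by rw [dendrimerN_zero]; rfl,
      Finset.filter_singleton, dendrimerDist_of_gt (by rw [dendrimerN_zero]; omega),
      dendrimerParent_level_zero (by simpa using hl), dendrimerDist_self]
    by_cases hi : i = 1
    · simp [hi]
    · rw [if_neg (by omega), if_neg (by omega), Finset.card_empty]
  | succ h ih =>
    have hl' := div_lt_level hd hl
    rcases i with _ | i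
    · rw [innerCard_zero]
      simp
    · rw [innerCard_succ hd, ih _ hl']
      obtain ⟨m, rfl | rfl⟩ := i.even_or_odd'
      · rcases m with _ | m
        · rw [mul_zero, levelCard_zero hl']
          simp
        · rw [levelCard_full hd h _ hl', show (2 * (m + 1) + 1 - 1) / 2 = m + 1 by omega,
            show (2 * (m + 1) - 1) / 2 = m by omega]
          have : d ^ m ≤ d ^ (m + 1) := Nat.pow_le_pow_right hd (Nat.le_succ m)
          rcases lt_trichotomy m h with hm | rfl | hm
          · rw [if_pos (by omega), if_pos hm, if_pos (by omega)]
            omega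
          · rw [if_neg (by omega), if_neg (by omega), if_pos rfl, if_pos (by omega), zero_add]
          · rw [if_neg (by omega), if_neg (by omega), if_neg (by omega), if_neg (by omega)]
      · rw [levelCard_odd hd hl' le_rfl, show (2 * m + 1 + 1 - 1) / 2 = m by omega,
          show (2 * m + 1 - 1) / 2 = m by omega, add_zero]
        exact if_congr (by omega) rfl rfl

theorem sphereCard_zero (d u : ℕ) : sphereCard d u 0 = 0 := by
  rw [sphereCard, Finset.card_eq_zero, Finset.filter_eq_empty_iff]
  intro v hv h0
  rw [dendrimerDist_eq_zero] at h0
  rw [Finset.mem_Ico] at hv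
  omega

theorem sphereCard_odd {d : ℕ} (hd : 1 ≤ d) {k l : ℕ} (hl : l < (d + 1) * d ^ k) (m : ℕ) :
    sphereCard d (dendrimerN d k + l) (2 * m + 1) = if m ≤ k then d ^ m else 0 := by
  rw [sphereCard_level, innerCard_eq hd k l hl, levelCard_odd hd hl hl.le, add_zero,
    show (2 * m + 1 - 1) / 2 = m by omega]
  exact if_congr (by omega) rfl rfl

theorem sphereCard_even {d : ℕ} (hd : 1 ≤ d) {k l : ℕ} (hl : l < (d + 1) * d ^ k) (m : ℕ) :
    sphereCard d (dendrimerN d k + l) (2 * m + 2) =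
      if m < k then d ^ m + d ^ m * (l / d ^ m % d)
      else if m = k then d ^ k * (l / d ^ k) else 0 := by
  rw [sphereCard_level, innerCard_eq hd k l hl, show 2 * m + 2 = 2 * (m + 1) by ring,
    levelCard_initial hd k l hl, show (2 * (m + 1) - 1) / 2 = m by omega]
  by_cases hm : m < k
  · rw [if_pos (by omega), if_pos hm, if_pos hm]
  · rw [if_neg (by omega), if_neg hm, if_neg hm, zero_add]

/-! ### Growth of the coefficients while a level fills. -/

/-- The number of pairs of nodes at distance `i`, both smaller than `n`. -/
def pairCount (d n i : ℕ) : ℕ := ∑ u ∈ Finset.Ico 1 n, sphereCard d u i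

theorem pairCount_add {d n : ℕ} (hn : 1 ≤ n) (L i : ℕ) :
    pairCount d (n + L) i = pairCount d n i + ∑ l ∈ Finset.range L, sphereCard d (n + l) i := by
  rw [pairCount, pairCount, ← Finset.sum_Ico_consecutive _ hn (Nat.le_add_right n L),
    Finset.sum_Ico_eq_sum_range _ n]
  simp

theorem pairCount_dendrimerN_add (d k L i : ℕ) :
    pairCount d (dendrimerN d k + L) i =
      pairCount d (dendrimerN d k) i +
        ∑ l ∈ Finset.range L, sphereCard d (dendrimerN d k + l) i :=
  pairCount_add ((two_le_dendrimerN d k).trans' one_le_two) L i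

theorem pairCount_zero (d n : ℕ) : pairCount d n 0 = 0 :=
  Finset.sum_eq_zero fun u _ => sphereCard_zero d u

/-- A base-`d` digit `c` satisfies `1 ≤ 1 + c ≤ d`, whence `d ^ m ≤ d ^ m * (1 + c) ≤ d ^ (m + 1)`.
-/
theorem sphereCard_le_succ {d : ℕ} (hd : 1 ≤ d) {k l i : ℕ} (hl : l < (d + 1) * d ^ k)
    (hi : i ≤ 2 * k) :
    sphereCard d (dendrimerN d k + l) i ≤ sphereCard d (dendrimerN d k + l) (i + 1) := by
  obtain ⟨m, rfl | rfl⟩ := i.even_or_odd'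
  · rcases m with _ | m
    · rw [mul_zero, sphereCard_zero]
      exact Nat.zero_le _
    · rw [sphereCard_odd hd hl, if_pos (by omega), show 2 * (m + 1) = 2 * m + 2 by ring,
        sphereCard_even hd hl, if_pos (by omega), pow_succ]
      have := Nat.mod_lt (l / d ^ m) hd
      refine le_trans (le_of_eq ?_) (Nat.mul_le_mul_left (d ^ m) (show 1 + l / d ^ m % d ≤ d by omega))
      ring
  · rw [sphereCard_odd hd hl, if_pos (by omega), sphereCard_even hd hl, if_pos (by omega)]
    exact Nat.le_add_right _ _

theorem sphereCard_eq_zero {d : ℕ} (hd : 1 ≤ d) {k l i : ℕ} (hl : l < (d + 1) * d ^ k)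
    (hi : 2 * k + 2 < i) : sphereCard d (dendrimerN d k + l) i = 0 := by
  obtain ⟨m, rfl | rfl⟩ := i.even_or_odd'
  · obtain ⟨m, rfl⟩ : ∃ m', m = m' + 1 := ⟨m - 1, by omega⟩
    rw [show 2 * (m + 1) = 2 * m + 2 by ring, sphereCard_even hd hl, if_neg (by omega),
      if_neg (by omega)]
  · rw [sphereCard_odd hd hl, if_neg (by omega)]

theorem two_mul_sum_range_id (n : ℕ) : 2 * ∑ x ∈ Finset.range (n + 1), x = (n + 1) * n := by
  rw [mul_comm, Finset.sum_range_id_mul_two]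
  simp

/-- The distance distribution of the dendrimer all of whose levels, the last one being the
`k`-th, are complete. -/
structure IsCompleteLevel (d k : ℕ) : Prop where
  mono : ∀ i < 2 * k, pairCount d (dendrimerN d k) i ≤ pairCount d (dendrimerN d k) (i + 1)
  eq_zero : ∀ i, 2 * k < i → pairCount d (dendrimerN d k) i = 0
  -- For `k ≥ 1` this is an equality; it serves to compare `a_{2k}` with `a_{2k+1}` at `L = 3 * d ^
  -- k`.
  bound : 2 * d * pairCount d (dendrimerN d k) (2 * k) ≤ (d + 1) * (d ^ k) ^ 2

namespace IsCompleteLevel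

variable {d k L : ℕ}

theorem pairCount_mono (hk : IsCompleteLevel d k) (hd : 1 ≤ d) (hL : L ≤ (d + 1) * d ^ k) {i : ℕ} (hi : i < 2 * k) :
    pairCount d (dendrimerN d k + L) i ≤ pairCount d (dendrimerN d k + L) (i + 1) := by
  rw [pairCount_dendrimerN_add, pairCount_dendrimerN_add]
  refine Nat.add_le_add (hk.mono i hi) (Finset.sum_le_sum fun l hl => ?_)
  exact sphereCard_le_succ hd ((Finset.mem_range.1 hl).trans_le hL) hi.le

theorem pairCount_eq_zero (hk : IsCompleteLevel d k) (hd : 1 ≤ d) (hL : L ≤ (d + 1) * d ^ k) {i : ℕ} (hi : 2 * k + 2 < i) :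
    pairCount d (dendrimerN d k + L) i = 0 := by
  rw [pairCount_dendrimerN_add, hk.eq_zero i (by omega), zero_add]
  exact Finset.sum_eq_zero fun l hl =>
    sphereCard_eq_zero hd ((Finset.mem_range.1 hl).trans_le hL) hi

theorem pairCount_odd (hk : IsCompleteLevel d k) (hd : 1 ≤ d) (hL : L ≤ (d + 1) * d ^ k) :
    pairCount d (dendrimerN d k + L) (2 * k + 1) = d ^ k * L := by
  rw [pairCount_dendrimerN_add, hk.eq_zero _ (by omega), zero_add,
    Finset.sum_const_nat (m := d ^ k), Finset.card_range, mul_comm]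
  intro l hl
  rw [sphereCard_odd hd ((Finset.mem_range.1 hl).trans_le hL), if_pos le_rfl]

theorem pairCount_top (hk : IsCompleteLevel d k) (hd : 1 ≤ d) (hL : L ≤ (d + 1) * d ^ k) :
    pairCount d (dendrimerN d k + L) (2 * k + 2) = d ^ k * ∑ l ∈ Finset.range L, l / d ^ k := by
  rw [pairCount_dendrimerN_add, hk.eq_zero _ (by omega), zero_add, Finset.mul_sum]
  refine Finset.sum_congr rfl fun l hl => ?_
  rw [sphereCard_even hd ((Finset.mem_range.1 hl).trans_le hL), if_neg (by omega), if_pos rfl]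

theorem three_mul_le (hd : 2 ≤ d) (k : ℕ) : 3 * d ^ k ≤ (d + 1) * d ^ k :=
  Nat.mul_le_mul_right _ (by omega)

/-- Over `3 * d ^ k` consecutive indices from `0` the leading relevant digit takes each value
equally often, so the new pairs at distance `2k` can be summed exactly; `bound` controls the old
ones. -/
theorem pairCount_three_mul (hk : IsCompleteLevel d k) (hd : 2 ≤ d) :
    pairCount d (dendrimerN d k + 3 * d ^ k) (2 * k) ≤ d ^ k * (3 * d ^ k) := by
  rcases k with _ | k
  · rw [mul_zero, pairCount_zero]
    exact Nat.zero_le _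
  have hD : 1 ≤ d ^ k := Nat.one_le_pow _ _ (by omega)
  have hsum : ∑ l ∈ Finset.range (3 * d ^ (k + 1)),
      sphereCard d (dendrimerN d (k + 1) + l) (2 * (k + 1)) =
      d ^ k * (3 * d ^ (k + 1)) + d ^ k * (d ^ k * (3 * ∑ x ∈ Finset.range d, x)) := by
    have hmod : ∑ x ∈ Finset.range (3 * d), x % d = 3 * ∑ x ∈ Finset.range d, x := by
      have h0 : ∑ x ∈ Finset.range d, x % d = ∑ x ∈ Finset.range d, x :=
        Finset.sum_congr rfl fun x hx => Nat.mod_eq_of_lt (Finset.mem_range.1 hx)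
      rw [show 3 * d = d + d + d by ring, Finset.sum_range_add, Finset.sum_range_add]
      simp only [← two_mul, Nat.mul_add_mod_self_right, Nat.add_mod_left, h0]
      ring
    rw [← hmod, ← sum_range_mul_div hD (3 * d) fun x => x % d,
      show d ^ k * (3 * d) = 3 * d ^ (k + 1) by ring, Finset.mul_sum]
    rw [show d ^ k * (3 * d ^ (k + 1)) = ∑ l ∈ Finset.range (3 * d ^ (k + 1)), d ^ k by
      simp [mul_comm], ← Finset.sum_add_distrib]
    refine Finset.sum_congr rfl fun l hl => ?_
    rw [show 2 * (k + 1) = 2 * k + 2 by ring,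
      sphereCard_even (by omega) ((Finset.mem_range.1 hl).trans_le (three_mul_le hd _)),
      if_pos (Nat.lt_succ_self k)]
  rw [pairCount_dendrimerN_add, hsum]
  have hb := hk.bound
  obtain ⟨e, rfl⟩ : ∃ e, d = e + 2 := ⟨d - 2, by omega⟩
  have hS := two_mul_sum_range_id (e + 1)
  rw [show e + 1 + 1 = e + 2 by ring] at hS
  refine le_of_mul_le_mul_left ?_ (show 0 < 2 * (e + 2) by omega)
  rw [pow_succ _ k] at hb ⊢
  generalize (e + 2) ^ k = D at *
  generalize ∑ x ∈ Finset.range (e + 2), x = S at *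
  generalize pairCount _ _ _ = A at *
  calc _ = 2 * (e + 2) * A + (e + 2) * (6 * D * (D * (e + 2)) + 3 * D * D * (2 * S)) := by ring
    _ ≤ (e + 2 + 1) * (D * (e + 2)) ^ 2 +
        (e + 2) * (6 * D * (D * (e + 2)) + 3 * D * D * ((e + 2) * (e + 1))) := by
      rw [hS]
      exact Nat.add_le_add_right hb _
    _ ≤ _ := by
      -- The exact difference of the two sides, with `e = d - 2`; it vanishes for `d = 2`.
      have : 0 ≤ 2 * e * (D * (e + 2)) ^ 2 := Nat.zero_le _
      nlinarith

theorem pairCount_middle (hk : IsCompleteLevel d k) (hd : 2 ≤ d) (hL : L ≤ (d + 1) * d ^ k) (hL3 : 3 * d ^ k ≤ L) :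
    pairCount d (dendrimerN d k + L) (2 * k) ≤
      pairCount d (dendrimerN d k + L) (2 * k + 1) := by
  induction L, hL3 using Nat.le_induction with
  | base =>
    rw [hk.pairCount_odd (by omega) hL]
    exact hk.pairCount_three_mul hd
  | succ L hL3 ih =>
    rw [← add_assoc, pairCount_add (L := 1) (by have := two_le_dendrimerN d k; omega),
      pairCount_add (L := 1) (by have := two_le_dendrimerN d k; omega)]
    simp only [Finset.sum_range_one, add_zero]
    exact Nat.add_le_add (ih (by omega)) (sphereCard_le_succ (by omega) (by omega) le_rfl)

/-- The source of the threshold: three blocks of length `P` give `0 + P + 2 * P`. -/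
theorem sum_div_three_mul {P : ℕ} (hP : 1 ≤ P) : ∑ l ∈ Finset.range (3 * P), l / P = 3 * P := by
  rw [mul_comm 3 P, sum_range_mul_div hP 3 fun x => x]
  rfl

theorem le_sum_div {P : ℕ} (hP : 1 ≤ P) (hL : 3 * P ≤ L) :
    L ≤ ∑ l ∈ Finset.range L, l / P := by
  induction L, hL using Nat.le_induction with
  | base => exact (sum_div_three_mul hP).ge
  | succ L hL ih =>
    rw [Finset.sum_range_succ]
    exact Nat.add_le_add ih (Nat.div_pos (by omega) hP)

theorem sum_div_le {P : ℕ} (hP : 1 ≤ P) (hL : L ≤ 3 * P) :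
    ∑ l ∈ Finset.range L, l / P ≤ L := by
  rcases le_total L (2 * P) with h | h
  · refine (Finset.sum_le_card_nsmul _ _ 1 fun l hl => ?_).trans (by simp)
    rw [← Nat.lt_add_one_iff, Nat.div_lt_iff_lt_mul hP]
    exact (Finset.mem_range.1 hl).trans_le h
  -- From `2 * P` on, argue backwards from the equality at `3 * P`: each missing term is at least 1.
  · have h1 := Finset.sum_range_add_sum_Ico (fun l => l / P) hL
    have h2 := Finset.card_nsmul_le_sum (Finset.Ico L (3 * P)) (fun l => l / P) 1 fun l hl =>
      Nat.div_pos (by rw [Finset.mem_Ico] at hl; omega) hP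
    rw [sum_div_three_mul hP] at h1
    rw [Nat.card_Ico, smul_eq_mul, mul_one] at h2
    omega

theorem top_le_odd (hk : IsCompleteLevel d k) (hd : 2 ≤ d) (hL : L ≤ 3 * d ^ k) :
    pairCount d (dendrimerN d k + L) (2 * k + 2) ≤
      pairCount d (dendrimerN d k + L) (2 * k + 1) := by
  have hL' := hL.trans (three_mul_le hd k)
  rw [hk.pairCount_odd (by omega) hL', hk.pairCount_top (by omega) hL']
  exact Nat.mul_le_mul_left _ (sum_div_le (Nat.one_le_pow _ _ (by omega)) hL)

theorem odd_le_top (hk : IsCompleteLevel d k) (hd : 2 ≤ d) (hL : L ≤ (d + 1) * d ^ k) (hL3 : 3 * d ^ k ≤ L) :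
    pairCount d (dendrimerN d k + L) (2 * k + 1) ≤
      pairCount d (dendrimerN d k + L) (2 * k + 2) := by
  rw [hk.pairCount_odd (by omega) hL, hk.pairCount_top (by omega) hL]
  exact Nat.mul_le_mul_left _ (le_sum_div (Nat.one_le_pow _ _ (by omega)) hL3)

theorem mono_top (hk : IsCompleteLevel d k) (hd : 2 ≤ d) (hL : L ≤ (d + 1) * d ^ k) (hL3 : 3 * d ^ k ≤ L) {i : ℕ}
    (hi : i < 2 * k + 2) :
    pairCount d (dendrimerN d k + L) i ≤ pairCount d (dendrimerN d k + L) (i + 1) := by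
  obtain h | rfl | rfl : i < 2 * k ∨ i = 2 * k ∨ i = 2 * k + 1 := by omega
  · exact hk.pairCount_mono (by omega) hL h
  · exact hk.pairCount_middle hd hL hL3
  · exact hk.odd_le_top hd hL hL3

theorem succ (hk : IsCompleteLevel d k) (hd : 2 ≤ d) : IsCompleteLevel d (k + 1) where
  mono i hi := by
    rw [dendrimerN_succ]
    exact hk.mono_top hd le_rfl (three_mul_le hd k) hi
  eq_zero i hi := by
    rw [dendrimerN_succ]
    exact hk.pairCount_eq_zero (by omega) le_rfl hi
  bound := by
    have hS := two_mul_sum_range_id d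
    rw [dendrimerN_succ, show 2 * (k + 1) = 2 * k + 2 by ring, hk.pairCount_top (by omega) le_rfl,
      mul_comm (d + 1) (d ^ k), sum_range_mul_div (Nat.one_le_pow _ _ (by omega)) _ fun x => x]
    refine le_of_eq ?_
    calc _ = d * d ^ k * d ^ k * (2 * ∑ x ∈ Finset.range (d + 1), x) := by ring
      _ = _ := by
        rw [hS]
        ring

end IsCompleteLevel

theorem isCompleteLevel {d : ℕ} (hd : 2 ≤ d) (k : ℕ) : IsCompleteLevel d k := by
  induction k with
  | zero =>
    refine ⟨by simp, fun i _ => ?_, by simp [pairCount_zero]⟩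
    simp [dendrimerN_zero, pairCount, sphereCard]
  | succ k ih => exact ih.succ hd

/-! ### The threshold and the assembly. -/

/-- `pairCount d (n + 1)` describes the tree on `n` nodes, so `n = p_k` corresponds to `L = 3 * d ^
k`. -/
theorem dendrimerP_add_one (d k : ℕ) : dendrimerP d k + 1 = dendrimerN d k + 3 * d ^ k := by
  have h : ∑ i ∈ Finset.range k, d ^ i + d ^ k = d * ∑ i ∈ Finset.range k, d ^ i + 1 := by
    rw [← Finset.sum_range_succ, geom_sum_succ]
  have h' : (d + 1) * ∑ i ∈ Finset.range k, d ^ i =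
      d * ∑ i ∈ Finset.range k, d ^ i + ∑ i ∈ Finset.range k, d ^ i := by ring
  rw [dendrimerP, dendrimerM, dendrimerN, mul_assoc]
  omega

theorem exists_level {d n : ℕ} (hd : 1 ≤ d) (hn : 2 ≤ n) :
    ∃ k L, L ≤ (d + 1) * d ^ k ∧ n + 1 = dendrimerN d k + L := by
  induction n, hn using Nat.le_induction with
  | base => exact ⟨0, 1, by simp, by rw [dendrimerN_zero]⟩
  | succ n hn ih =>
    obtain ⟨k, L, hL, h⟩ := ih
    rcases hL.lt_or_eq with hlt | rfl
    · exact ⟨k, L + 1, hlt, by omega⟩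
    · refine ⟨k + 1, 1, ?_, by rw [dendrimerN_succ, h]⟩
      exact Nat.mul_pos (by omega) (Nat.pow_pos hd)

theorem le_peak {a : ℕ → ℕ} {j : ℕ} (h₁ : ∀ i, i < j → a i ≤ a (i + 1))
    (h₂ : ∀ i, j ≤ i → a (i + 1) ≤ a i) (i : ℕ) : a i ≤ a j := by
  rcases le_total i j with h | h
  · induction h using Nat.decreasingInduction with
    | self => exact le_rfl
    | of_succ i hi ih => exact (h₁ i hi).trans ih
  · induction i, h using Nat.le_induction with
    | base => exact le_rfl
    | succ i hi ih => exact (h₂ i hi).trans ih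

theorem mainTheorem1 (d n : ℕ) (hd : 2 ≤ d) (hn : 1 ≤ n) :
    IsUnimodal (wienerPolynomial (dendrimer n d)).coeff ∧
    (∀ k : ℕ, dendrimerN d k ≤ n → n < dendrimerP d k →
      (∀ i, (wienerPolynomial (dendrimer n d)).coeff i ≤
          (wienerPolynomial (dendrimer n d)).coeff (2 * k)) ∨
      (∀ i, (wienerPolynomial (dendrimer n d)).coeff i ≤
          (wienerPolynomial (dendrimer n d)).coeff (2 * k + 1))) ∧
    (∀ k : ℕ, dendrimerP d k ≤ n → n < dendrimerN d (k + 1) →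
      (∀ i, (wienerPolynomial (dendrimer n d)).coeff i ≤
          (wienerPolynomial (dendrimer n d)).coeff (2 * k + 2)) ∧
      (wienerPolynomial (dendrimer n d)).natDegree = 2 * k + 2 ∧
      (∀ i, i < 2 * k + 2 → (wienerPolynomial (dendrimer n d)).coeff i ≤
          (wienerPolynomial (dendrimer n d)).coeff (i + 1))) := by
  have hd1 : 1 ≤ d := by omega
  have hcoeff : ∀ i, (wienerPolynomial (dendrimer n d)).coeff i = pairCount d (n + 1) i :=
    coeff_wienerPolynomial_dendrimer hd1
  have low : ∀ k L, n + 1 = dendrimerN d k + L → L ≤ 3 * d ^ k →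
      ∃ j, (j = 2 * k ∨ j = 2 * k + 1) ∧
        (∀ i, i < j → pairCount d (n + 1) i ≤ pairCount d (n + 1) (i + 1)) ∧
        ∀ i, j ≤ i → pairCount d (n + 1) (i + 1) ≤ pairCount d (n + 1) i := by
    intro k L hL hL3
    have hk := isCompleteLevel hd k
    have hL' := hL3.trans (IsCompleteLevel.three_mul_le hd k)
    have hinc := fun i => hk.pairCount_mono hd1 hL' (i := i)
    have htop := hk.top_le_odd hd hL3
    have hzero := fun i => hk.pairCount_eq_zero hd1 hL' (i := i)
    rw [← hL] at hinc htop hzero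
    have hdec : ∀ i, 2 * k + 1 ≤ i → pairCount d (n + 1) (i + 1) ≤ pairCount d (n + 1) i := by
      intro i hi
      rcases hi.eq_or_lt with rfl | hi
      · exact htop
      · rw [hzero (i + 1) (by omega)]
        exact Nat.zero_le _
    -- The one undetermined comparison; its outcome decides between the two peaks.
    rcases le_total (pairCount d (n + 1) (2 * k)) (pairCount d (n + 1) (2 * k + 1)) with h | h
    · refine ⟨2 * k + 1, Or.inr rfl, fun i hi => ?_, hdec⟩
      rcases (Nat.lt_succ_iff.1 hi).eq_or_lt with rfl | hi
      · exact h
      · exact hinc i hi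
    · refine ⟨2 * k, Or.inl rfl, hinc, fun i hi => ?_⟩
      rcases hi.eq_or_lt with rfl | hi
      · exact h
      · exact hdec i hi
  have high : ∀ k L, n + 1 = dendrimerN d k + L → 3 * d ^ k ≤ L → L ≤ (d + 1) * d ^ k →
      (∀ i, i < 2 * k + 2 → pairCount d (n + 1) i ≤ pairCount d (n + 1) (i + 1)) ∧
        (∀ i, 2 * k + 2 ≤ i → pairCount d (n + 1) (i + 1) ≤ pairCount d (n + 1) i) ∧
        (∀ i, 2 * k + 2 < i → pairCount d (n + 1) i = 0) ∧
        pairCount d (n + 1) (2 * k + 2) ≠ 0 := by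
    intro k L hL hL3 hL'
    have hk := isCompleteLevel hd k
    have hzero := fun i => hk.pairCount_eq_zero hd1 hL' (i := i)
    have hodd := hk.pairCount_odd hd1 hL'
    have htop := hk.odd_le_top hd hL' hL3
    have hinc := fun i => hk.mono_top hd hL' hL3 (i := i)
    rw [← hL] at hzero hodd htop hinc
    refine ⟨hinc, fun i hi => ?_, hzero, ?_⟩
    · rw [hzero (i + 1) (by omega)]
      exact Nat.zero_le _
    · have hP : 0 < d ^ k := Nat.pow_pos hd1
      have := Nat.mul_pos hP (hP.trans_le (show d ^ k ≤ L by omega))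
      omega
  refine ⟨?_, fun k hk hk' => ?_, fun k hk hk' => ?_⟩
  · simp only [IsUnimodal, hcoeff]
    rcases hn.eq_or_lt with rfl | h2
    · exact ⟨0, by simp, by simp [pairCount, sphereCard]⟩
    · obtain ⟨k, L, hL, h⟩ := exists_level hd1 h2
      rcases le_total L (3 * d ^ k) with h3 | h3
      · obtain ⟨j, -, hj⟩ := low k L h h3
        exact ⟨j, hj⟩
      · obtain ⟨h₁, h₂, -⟩ := high k L h h3 hL
        exact ⟨_, h₁, h₂⟩
  · simp only [hcoeff]
    have hp := dendrimerP_add_one d k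
    obtain ⟨j, rfl | rfl, h₁, h₂⟩ := low k (n + 1 - dendrimerN d k) (by omega) (by omega)
    · exact Or.inl (le_peak h₁ h₂)
    · exact Or.inr (le_peak h₁ h₂)
  · have hp := dendrimerP_add_one d k
    have hs := dendrimerN_succ d k
    obtain ⟨h₁, h₂, h₃, h₄⟩ :=
      high k (n + 1 - dendrimerN d k) (by omega) (by omega) (by omega)
    simp only [hcoeff]
    refine ⟨le_peak h₁ h₂, Polynomial.natDegree_eq_of_le_of_coeff_ne_zero ?_ ?_, h₁⟩
    · rw [Polynomial.natDegree_le_iff_coeff_eq_zero]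
      intro i hi
      rw [hcoeff, h₃ i hi]
    · rwa [hcoeff]
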